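/- Let $0<p<1/\sqrt2$ and $q=\sqrt{1-p^2}$. Let $F_p(\phi)=\int_0^\phi (1-p^2\sin^2\varphi)^{-1/2}\,d\varphi$ and $E_p(\phi)=\int_0^\phi\sqrt{1-p^2\sin^2\varphi}\,d\varphi$, let $\operatorname{am}_p=F_p^{-1}$ be the Jacobi amplitude, and put $\operatorname{sn}_p=\sin\circ\operatorname{am}_p$, $\operatorname{cn}_p=\cos\circ\operatorname{am}_p$, $\operatorname{dn}_p=\sqrt{1-p^2\operatorname{sn}_p^2}$. Consider the surface of revolution $$x(s,\vartheta)=(r(s)\cos\vartheta,\,r(s)\sin\vartheta,\,h(s)),\qquad r(s)=\tfrac1p\operatorname{dn}_p(\tfrac sp),\quad h(s)=\tfrac1p E_p(\operatorname{am}_p(\tfrac sp))-\tfrac1{p^2}s,\qquad (s,\vartheta)\in\mathbb R^2,$$ and $n(s,\vartheta)=(-\operatorname{sn}_p(\tfrac sp)\cos\vartheta,\,-\operatorname{sn}_p(\tfrac sp)\sin\vartheta,\,\operatorname{cn}_p(\tfrac sp))$. Then: 1. $x$ and $n$ are smooth, $n$ is a unit normal field of $x$ (that is, $|n|=1$ and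 $n\perp x_s,x_\vartheta$ everywhere), and $x$ has Gauss curvature $K=-1$ at every point where it is an immersion. 2. $p/q<q/p$, and for every $t\in(p/q,\,q/p)$ the parallel surface $x^t=x+t\,n$ is a surface of revolution about the third axis, is a smooth immersion, and is complete in its induced metric. It has unit normal field $n$ and, with respect to it, is a linear Weingarten surface of hyperbolic type: there are real constants $a,b,c$ with $\Delta=b^2-ac<0$ such that its Gauss curvature $K$ and mean curvature $H$ satisfy $aK+2bH+c=0$ everywhere. Moreover it has a translational period: there are $T>0$ and $d\neq0$ with $x^t(s+T,\vartheta)=x^t(s,\vartheta)+(0,0,d)$ for all $s,\vartheta$. 3. Different $t\in(p/q,\,q/p)$ give different subsets $x^t(\mathbb R^2)$ of $\mathbb R^3$. Thus, for each such $p$, $(x^t)_{t\in(p/q,q/p)}$ is a one-parameter family of complete, immersed, rotational linear Weingarten surfaces with $\Delta<0$, each with a translational period. -/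

import Mathlib

open Set Filter Topology MeasureTheory
open scoped Real ContDiff RealInnerProductSpace

noncomputable section

/-! ### Elliptic integrals and Jacobi elliptic functions, modulus `p ∈ (0,1)` -/

/-- Incomplete elliptic integral of the first kind. -/
def ellipticF (p φ : ℝ) : ℝ := ∫ x in (0 : ℝ)..φ, 1 / √(1 - p ^ 2 * Real.sin x ^ 2)

/-- Incomplete elliptic integral of the second kind. -/
def ellipticE (p φ : ℝ) : ℝ := ∫ x in (0 : ℝ)..φ, √(1 - p ^ 2 * Real.sin x ^ 2)

/-- The Jacobi amplitude, the inverse function of `ellipticF p`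
(a bijection of `ℝ` for `p ∈ (0,1)`, see `ellipticF_bijective`). -/
def jacobiAm (p : ℝ) : ℝ → ℝ := Function.invFun (ellipticF p)

def jacobiSn (p u : ℝ) : ℝ := Real.sin (jacobiAm p u)

def jacobiCn (p u : ℝ) : ℝ := Real.cos (jacobiAm p u)

def jacobiDn (p u : ℝ) : ℝ := √(1 - p ^ 2 * jacobiSn p u ^ 2)

theorem ellipticF_bijective {p : ℝ} (hp0 : 0 < p) (hp1 : p < 1) :
    Function.Bijective (ellipticF p) := by
  have hpos : ∀ x : ℝ, 0 < 1 - p ^ 2 * Real.sin x ^ 2 := fun x => by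
    nlinarith [Real.sin_sq_le_one x, sq_nonneg (Real.sin x)]
  have hc : Continuous fun x : ℝ => 1 / √(1 - p ^ 2 * Real.sin x ^ 2) :=
    continuous_const.div (by fun_prop) fun x => (Real.sqrt_pos.2 (hpos x)).ne'
  have hge : ∀ x : ℝ, 1 ≤ 1 / √(1 - p ^ 2 * Real.sin x ^ 2) := fun x => by
    rw [le_div_iff₀ (Real.sqrt_pos.2 (hpos x)), one_mul, Real.sqrt_le_iff]
    exact ⟨zero_le_one, by nlinarith [sq_nonneg (p * Real.sin x)]⟩
  have key : ∀ a b : ℝ, a ≤ b → b - a ≤ ellipticF p b - ellipticF p a := fun a b hab => by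
    have h1 : ellipticF p b - ellipticF p a =
        ∫ x in a..b, 1 / √(1 - p ^ 2 * Real.sin x ^ 2) :=
      intervalIntegral.integral_interval_sub_left (hc.intervalIntegrable _ _)
        (hc.intervalIntegrable _ _)
    have h2 : ∫ _ in a..b, (1 : ℝ) ≤ ∫ x in a..b, 1 / √(1 - p ^ 2 * Real.sin x ^ 2) :=
      intervalIntegral.integral_mono hab (by simp) (hc.intervalIntegrable _ _) hge
    rw [h1]; simpa using h2
  have h0 : ellipticF p 0 = 0 := by simp [ellipticF]
  have hcont : Continuous (ellipticF p) :=
    intervalIntegral.continuous_primitive (fun a b => hc.intervalIntegrable a b) 0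
  refine ⟨StrictMono.injective fun a b hab => ?_, hcont.surjective ?_ ?_⟩
  · have := key a b hab.le
    linarith
  · refine tendsto_atTop_mono' _ ?_ tendsto_id
    filter_upwards [eventually_ge_atTop 0] with x hx
    have := key 0 x hx
    simp only [id]; linarith
  · refine tendsto_atBot_mono' _ ?_ tendsto_id
    filter_upwards [eventually_le_atBot 0] with x hx
    have := key x 0 hx
    simp only [id]; linarith

/-! ### Parametrized surfaces in Euclidean space -/

abbrev Space := EuclideanSpace ℝ (Fin 3)

/-- Partial derivatives with respect to the two parameters. -/
def partialFst (f : ℝ × ℝ → Space) (x : ℝ × ℝ) : Space := fderiv ℝ f x (1, 0)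

def partialSnd (f : ℝ × ℝ → Space) (x : ℝ × ℝ) : Space := fderiv ℝ f x (0, 1)

/-- `f` has rank two at `x`. -/
def IsRegularAt (f : ℝ × ℝ → Space) (x : ℝ × ℝ) : Prop := Function.Injective (fderiv ℝ f x)

/-- Smooth immersion of the parameter plane. -/
def IsImmersedSurface (f : ℝ × ℝ → Space) : Prop := ContDiff ℝ ∞ f ∧ ∀ x, IsRegularAt f x

/-- `n` is a smooth unit normal field along the (possibly singular) surface `f`. -/
def IsUnitNormalField (f n : ℝ × ℝ → Space) : Prop :=
  ContDiff ℝ ∞ n ∧ ∀ x, ‖n x‖ = 1 ∧ ⟪n x, partialFst f x⟫ = 0 ∧ ⟪n x, partialSnd f x⟫ = 0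

/-- Coefficients of the first fundamental form. -/
def coeffE (f : ℝ × ℝ → Space) (x : ℝ × ℝ) : ℝ := ⟪partialFst f x, partialFst f x⟫

def coeffF (f : ℝ × ℝ → Space) (x : ℝ × ℝ) : ℝ := ⟪partialFst f x, partialSnd f x⟫

def coeffG (f : ℝ × ℝ → Space) (x : ℝ × ℝ) : ℝ := ⟪partialSnd f x, partialSnd f x⟫

/-- Coefficients of the second fundamental form with respect to the unit normal `n`. -/
def coeffL (f n : ℝ × ℝ → Space) (x : ℝ × ℝ) : ℝ := ⟪partialFst (partialFst f) x, n x⟫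

def coeffM (f n : ℝ × ℝ → Space) (x : ℝ × ℝ) : ℝ := ⟪partialFst (partialSnd f) x, n x⟫

def coeffN (f n : ℝ × ℝ → Space) (x : ℝ × ℝ) : ℝ := ⟪partialSnd (partialSnd f) x, n x⟫

/-- Gauss curvature (at regular points). -/
def gaussCurvature (f n : ℝ × ℝ → Space) (x : ℝ × ℝ) : ℝ :=
  (coeffL f n x * coeffN f n x - coeffM f n x ^ 2) /
    (coeffE f x * coeffG f x - coeffF f x ^ 2)

/-- Mean curvature (at regular points), half the sum of the principal curvatures. -/
def meanCurvature (f n : ℝ × ℝ → Space) (x : ℝ × ℝ) : ℝ :=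
  (coeffE f x * coeffN f n x - 2 * coeffF f x * coeffM f n x + coeffG f x * coeffL f n x) /
    (2 * (coeffE f x * coeffG f x - coeffF f x ^ 2))

/-- The surface with unit normal `n` satisfies a linear Weingarten equation
`a K + 2 b H + c = 0` with discriminant `b² - a c < 0`. -/
def IsHyperbolicLinearWeingarten (f n : ℝ × ℝ → Space) : Prop :=
  ∃ a b c : ℝ, b ^ 2 - a * c < 0 ∧
    ∀ x, a * gaussCurvature f n x + 2 * b * meanCurvature f n x + c = 0

/-- Distance of the metric induced by `f` on the parameter plane: the infimum of the lengths of
the images under `f` of the `C¹` paths that join two parameter values. -/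
def inducedEDist (f : ℝ × ℝ → Space) (x y : ℝ × ℝ) : ENNReal :=
  ⨅ (γ : ℝ → ℝ × ℝ) (_ : ContDiff ℝ 1 γ ∧ γ 0 = x ∧ γ 1 = y),
    ∫⁻ τ in Icc (0 : ℝ) 1, ‖deriv (f ∘ γ) τ‖ₑ

/-- The induced metric is complete: every Cauchy sequence converges. -/
def IsCompleteSurface (f : ℝ × ℝ → Space) : Prop :=
  ∀ u : ℕ → ℝ × ℝ,
    (∀ ε : ENNReal, 0 < ε → ∃ m, ∀ i ≥ m, ∀ j ≥ m, inducedEDist f (u i) (u j) < ε) →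
    ∃ x, Tendsto (fun i => inducedEDist f (u i) x) atTop (𝓝 0)

/-- Surface of revolution about the third axis with profile curve `(r, h)`. -/
def revolutionSurface (r h : ℝ → ℝ) (x : ℝ × ℝ) : Space :=
  !₂[r x.1 * Real.cos x.2, r x.1 * Real.sin x.2, h x.1]

/-- A surface of revolution about the third axis has a translational period: shifting the profile
parameter by some `T` amounts to a nontrivial translation along the axis. -/
def HasTranslationalPeriod (f : ℝ × ℝ → Space) : Prop :=
  ∃ T d : ℝ, 0 < T ∧ d ≠ 0 ∧ ∀ s θ : ℝ, f (s + T, θ) = f (s, θ) + !₂[0, 0, d]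

/-- Parallel surface at distance `t`. -/
def parallelSurface (f n : ℝ × ℝ → Space) (t : ℝ) (x : ℝ × ℝ) : Space := f x + t • n x

/-! ### The pseudospherical surface of revolution of dn type -/

def dnRadius (p s : ℝ) : ℝ := 1 / p * jacobiDn p (s / p)

def dnHeight (p s : ℝ) : ℝ := 1 / p * ellipticE p (jacobiAm p (s / p)) - 1 / p ^ 2 * s

def dnSurface (p : ℝ) : ℝ × ℝ → Space := revolutionSurface (dnRadius p) (dnHeight p)

/-- The normal field obtained by rotating the normal `(-sn, cn)(s/p)` of the profile curve. -/
def dnNormal (p : ℝ) : ℝ × ℝ → Space :=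
  revolutionSurface (fun s => -jacobiSn p (s / p)) (fun s => jacobiCn p (s / p))

end

/-! ### Jacobi elliptic functions -/

/-! Write `σ = sn(s/p)`, `τ = cn(s/p)`, `ρ = dn(s/p)/p`. Then `σ' = ρτ`, `τ' = -ρσ` and the profile
satisfies `(r', h') = -σ(τ, σ)` with `r = ρ`: the radius is also the angular velocity of the normal
`(-σ, τ)`. Hence the parallel profile has velocity `-A(τ, σ)` with `A = σ + tρ` and radius `B = ρ -
tσ`, that is `B + iA = (1 + it)(ρ + iσ)`. The metric is `A² ds² + B² dϑ²` and the principal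
curvatures are `-ρ/A` and `σ/B`. At `t = 0` their product is `-1`; in general `(1 + t²)K + 2tH + 1 =
0` is a polynomial identity in `σ, ρ`, with discriminant `t² - (1 + t²) = -1`. All this rests on
`isFramedProfile_parallel`.

From `|σ| ≤ 1` and `ρ ≥ q/p` follow `A ≥ tq/p - 1` and `B ≥ q/p - t`, both positive exactly for `p/q
< t < q/p` (`exists_pos_le_parallel`). So the metric uniformly dominates the flat one, which gives
immersion and completeness (`isCompleteSurface_of_le_norm_fderiv`). The period comes from the
amplitude growing by `2π`, and `t` is recovered from the image because the largest distance to the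
axis is `q/p + t`. -/

theorem one_sub_mul_sin_sq_pos {p : ℝ} (hp0 : 0 < p) (hp1 : p < 1) (x : ℝ) :
    0 < 1 - p ^ 2 * Real.sin x ^ 2 := by
  nlinarith [Real.sin_sq_le_one x, sq_nonneg (Real.sin x)]

theorem continuous_ellipticF_integrand {p : ℝ} (hp0 : 0 < p) (hp1 : p < 1) :
    Continuous fun x : ℝ => 1 / √(1 - p ^ 2 * Real.sin x ^ 2) :=
  continuous_const.div (by fun_prop)
    fun x => (Real.sqrt_pos.2 (one_sub_mul_sin_sq_pos hp0 hp1 x)).ne'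

theorem hasDerivAt_ellipticF {p : ℝ} (hp0 : 0 < p) (hp1 : p < 1) (φ : ℝ) :
    HasDerivAt (ellipticF p) (1 / √(1 - p ^ 2 * Real.sin φ ^ 2)) φ :=
  (continuous_ellipticF_integrand hp0 hp1).integral_hasStrictDerivAt 0 φ |>.hasDerivAt

theorem hasDerivAt_ellipticE (p φ : ℝ) :
    HasDerivAt (ellipticE p) √(1 - p ^ 2 * Real.sin φ ^ 2) φ :=
  (show Continuous fun x : ℝ => √(1 - p ^ 2 * Real.sin x ^ 2) by
    fun_prop).integral_hasStrictDerivAt 0 φ |>.hasDerivAt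

theorem strictMono_ellipticF {p : ℝ} (hp0 : 0 < p) (hp1 : p < 1) : StrictMono (ellipticF p) :=
  strictMono_of_deriv_pos fun x => by
    rw [(hasDerivAt_ellipticF hp0 hp1 x).deriv]
    exact one_div_pos.2 (Real.sqrt_pos.2 (one_sub_mul_sin_sq_pos hp0 hp1 x))

theorem ellipticF_jacobiAm {p : ℝ} (hp0 : 0 < p) (hp1 : p < 1) (u : ℝ) :
    ellipticF p (jacobiAm p u) = u :=
  Function.rightInverse_invFun (ellipticF_bijective hp0 hp1).2 u

theorem jacobiAm_ellipticF {p : ℝ} (hp0 : 0 < p) (hp1 : p < 1) (φ : ℝ) :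
    jacobiAm p (ellipticF p φ) = φ :=
  Function.leftInverse_invFun (ellipticF_bijective hp0 hp1).1 φ

theorem continuous_jacobiAm {p : ℝ} (hp0 : 0 < p) (hp1 : p < 1) : Continuous (jacobiAm p) := by
  have hm : StrictMono (jacobiAm p) := fun a b hab => by
    rw [← (strictMono_ellipticF hp0 hp1).lt_iff_lt]
    simpa only [ellipticF_jacobiAm hp0 hp1] using hab
  -- A monotone surjection of the line has no jumps.
  exact hm.monotone.continuous_of_surjective fun φ => ⟨_, jacobiAm_ellipticF hp0 hp1 φ⟩

theorem jacobiDn_pos {p : ℝ} (hp0 : 0 < p) (hp1 : p < 1) (u : ℝ) : 0 < jacobiDn p u :=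
  Real.sqrt_pos.2 (one_sub_mul_sin_sq_pos hp0 hp1 _)

theorem jacobiDn_sq {p : ℝ} (hp0 : 0 < p) (hp1 : p < 1) (u : ℝ) :
    jacobiDn p u ^ 2 = 1 - p ^ 2 * jacobiSn p u ^ 2 :=
  Real.sq_sqrt (one_sub_mul_sin_sq_pos hp0 hp1 _).le

theorem jacobiSn_sq_add_jacobiCn_sq (p u : ℝ) : jacobiSn p u ^ 2 + jacobiCn p u ^ 2 = 1 :=
  Real.sin_sq_add_cos_sq _

theorem hasDerivAt_jacobiAm {p : ℝ} (hp0 : 0 < p) (hp1 : p < 1) (u : ℝ) :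
    HasDerivAt (jacobiAm p) (jacobiDn p u) u := by
  have h := HasDerivAt.of_local_left_inverse (continuous_jacobiAm hp0 hp1).continuousAt
    (hasDerivAt_ellipticF hp0 hp1 (jacobiAm p u))
    (one_div_pos.2 (jacobiDn_pos hp0 hp1 u)).ne'
    (Eventually.of_forall (ellipticF_jacobiAm hp0 hp1))
  simpa [jacobiDn, jacobiSn] using h

theorem hasDerivAt_jacobiSn {p : ℝ} (hp0 : 0 < p) (hp1 : p < 1) (u : ℝ) :
    HasDerivAt (jacobiSn p) (jacobiCn p u * jacobiDn p u) u :=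
  (hasDerivAt_jacobiAm hp0 hp1 u).sin

theorem hasDerivAt_jacobiCn {p : ℝ} (hp0 : 0 < p) (hp1 : p < 1) (u : ℝ) :
    HasDerivAt (jacobiCn p) (-jacobiSn p u * jacobiDn p u) u :=
  (hasDerivAt_jacobiAm hp0 hp1 u).cos

theorem hasDerivAt_jacobiDn {p : ℝ} (hp0 : 0 < p) (hp1 : p < 1) (u : ℝ) :
    HasDerivAt (jacobiDn p) (-(p ^ 2 * jacobiSn p u * jacobiCn p u)) u := by
  have hD := (jacobiDn_pos hp0 hp1 u).ne'
  have h := ((((hasDerivAt_jacobiSn hp0 hp1 u).pow 2).const_mul (p ^ 2)).const_sub 1).sqrt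
    (one_sub_mul_sin_sq_pos hp0 hp1 (jacobiAm p u)).ne'
  refine h.congr_deriv ?_
  change _ / (2 * jacobiDn p u) = _
  field_simp
  norm_num
  ring

/-- Bootstrapping: the derivative of `am` is `dn`, a smooth function of `am` itself, so each order
of regularity yields the next. -/
theorem contDiff_jacobiAm {p : ℝ} (hp0 : 0 < p) (hp1 : p < 1) : ContDiff ℝ ∞ (jacobiAm p) := by
  rw [contDiff_infty]
  intro n
  induction n with
  | zero => exact contDiff_zero.2 (continuous_jacobiAm hp0 hp1)
  | succ n ih =>
    push_cast
    rw [contDiff_succ_iff_deriv]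
    refine ⟨fun u => (hasDerivAt_jacobiAm hp0 hp1 u).differentiableAt, by simp, ?_⟩
    rw [show deriv (jacobiAm p) = jacobiDn p from
      funext fun u => (hasDerivAt_jacobiAm hp0 hp1 u).deriv]
    exact (contDiff_const.sub (contDiff_const.mul (ih.sin.pow 2))).sqrt
      fun u => (one_sub_mul_sin_sq_pos hp0 hp1 _).ne'

theorem contDiff_jacobiSn {p : ℝ} (hp0 : 0 < p) (hp1 : p < 1) : ContDiff ℝ ∞ (jacobiSn p) :=
  (contDiff_jacobiAm hp0 hp1).sin

theorem contDiff_jacobiCn {p : ℝ} (hp0 : 0 < p) (hp1 : p < 1) : ContDiff ℝ ∞ (jacobiCn p) :=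
  (contDiff_jacobiAm hp0 hp1).cos

theorem contDiff_jacobiDn {p : ℝ} (hp0 : 0 < p) (hp1 : p < 1) : ContDiff ℝ ∞ (jacobiDn p) :=
  (contDiff_const.sub (contDiff_const.mul ((contDiff_jacobiSn hp0 hp1).pow 2))).sqrt
    fun _ => (one_sub_mul_sin_sq_pos hp0 hp1 _).ne'

/-! ### Quasi-periodicity of the elliptic integrals and the amplitude -/

theorem ellipticF_add_two_pi {p : ℝ} (hp0 : 0 < p) (hp1 : p < 1) (φ : ℝ) :
    ellipticF p (φ + 2 * π) = ellipticF p φ + ellipticF p (2 * π) := by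
  have hi := fun a b => (continuous_ellipticF_integrand hp0 hp1).intervalIntegrable (μ := volume) a b
  have hper : Function.Periodic (fun x : ℝ => 1 / √(1 - p ^ 2 * Real.sin x ^ 2)) (2 * π) :=
    fun x => by simp
  have := hper.intervalIntegral_add_eq φ 0
  simp only [zero_add] at this
  simp only [ellipticF, ← this]
  exact (intervalIntegral.integral_add_adjacent_intervals (hi _ _) (hi _ _)).symm

theorem ellipticE_add_two_pi (p φ : ℝ) :
    ellipticE p (φ + 2 * π) = ellipticE p φ + ellipticE p (2 * π) := by
  have hc : Continuous fun x : ℝ => √(1 - p ^ 2 * Real.sin x ^ 2) := by fun_prop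
  have hi := fun a b => hc.intervalIntegrable (μ := volume) a b
  have hper : Function.Periodic (fun x : ℝ => √(1 - p ^ 2 * Real.sin x ^ 2)) (2 * π) :=
    fun x => by simp
  have := hper.intervalIntegral_add_eq φ 0
  simp only [zero_add] at this
  simp only [ellipticE, ← this]
  exact (intervalIntegral.integral_add_adjacent_intervals (hi _ _) (hi _ _)).symm

theorem jacobiAm_add_ellipticF_two_pi {p : ℝ} (hp0 : 0 < p) (hp1 : p < 1) (u : ℝ) :
    jacobiAm p (u + ellipticF p (2 * π)) = jacobiAm p u + 2 * π := by
  apply (strictMono_ellipticF hp0 hp1).injective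
  rw [ellipticF_jacobiAm hp0 hp1, ellipticF_add_two_pi hp0 hp1, ellipticF_jacobiAm hp0 hp1]

theorem ellipticF_two_pi_pos {p : ℝ} (hp0 : 0 < p) (hp1 : p < 1) : 0 < ellipticF p (2 * π) := by
  simpa [ellipticF] using strictMono_ellipticF hp0 hp1 Real.two_pi_pos

/-- The integrands are `√w ≤ 1/√w` with `0 < w ≤ 1`, strict at `π/2`. This makes the axial
translation nonzero. -/
theorem ellipticE_two_pi_lt_ellipticF_two_pi {p : ℝ} (hp0 : 0 < p) (hp1 : p < 1) :
    ellipticE p (2 * π) < ellipticF p (2 * π) := by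
  refine intervalIntegral.integral_lt_integral_of_continuousOn_of_le_of_exists_lt
    Real.two_pi_pos (by fun_prop) (continuous_ellipticF_integrand hp0 hp1).continuousOn
    (fun x _ => ?_) ⟨π / 2, ⟨by positivity, by linarith [Real.pi_pos]⟩, ?_⟩
  · have h := one_sub_mul_sin_sq_pos hp0 hp1 x
    rw [le_div_iff₀ (Real.sqrt_pos.2 h), Real.mul_self_sqrt h.le]
    nlinarith [sq_nonneg (p * Real.sin x)]
  · have h := one_sub_mul_sin_sq_pos hp0 hp1 (π / 2)
    rw [lt_div_iff₀ (Real.sqrt_pos.2 h), Real.mul_self_sqrt h.le, Real.sin_pi_div_two]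
    nlinarith

/-! ### Surfaces of revolution -/

theorem space_inner (a b c a' b' c' : ℝ) :
    ⟪(!₂[a, b, c] : Space), !₂[a', b', c']⟫ = a * a' + b * b' + c * c' := by
  simp [PiLp.inner_apply, Fin.sum_univ_three, mul_comm]

theorem hasFDerivAt_space {E : Type*} [NormedAddCommGroup E] [NormedSpace ℝ E]
    {f₀ f₁ f₂ : E → ℝ} {f₀' f₁' f₂' : E →L[ℝ] ℝ} {x : E}
    (h₀ : HasFDerivAt f₀ f₀' x) (h₁ : HasFDerivAt f₁ f₁' x) (h₂ : HasFDerivAt f₂ f₂' x) :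
    ∃ L : E →L[ℝ] Space, HasFDerivAt (fun y => (!₂[f₀ y, f₁ y, f₂ y] : Space)) L x ∧
      ∀ v, L v = !₂[f₀' v, f₁' v, f₂' v] := by
  have h : HasFDerivAt (fun y => ![f₀ y, f₁ y, f₂ y])
      (ContinuousLinearMap.pi ![f₀', f₁', f₂']) x := by
    rw [hasFDerivAt_pi']
    intro i
    fin_cases i
    · exact h₀
    · exact h₁
    · exact h₂
  refine ⟨_, (PiLp.continuousLinearEquiv 2 ℝ (fun _ : Fin 3 => ℝ)).symm.toContinuousLinearMap.hasFDerivAt.comp x h, fun v => ?_⟩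
  ext i
  fin_cases i <;> simp

theorem contDiff_revolutionSurface {r h : ℝ → ℝ} (hr : ContDiff ℝ ∞ r) (hh : ContDiff ℝ ∞ h) :
    ContDiff ℝ ∞ (revolutionSurface r h) := by
  rw [contDiff_euclidean]
  intro i
  fin_cases i
  · exact (hr.comp contDiff_fst).mul (Real.contDiff_cos.comp contDiff_snd)
  · exact (hr.comp contDiff_fst).mul (Real.contDiff_sin.comp contDiff_snd)
  · exact hh.comp contDiff_fst

/-- The form `a(cos, sin) + b(sin, -cos)` covers both the surface of revolution (`b = 0`) and its
angular derivative (`a = 0`), so one formula serves first and second derivatives. -/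
theorem fderiv_rotated {a b c : ℝ → ℝ} {x : ℝ × ℝ} {a' b' c' : ℝ} (ha : HasDerivAt a a' x.1)
    (hb : HasDerivAt b b' x.1) (hc : HasDerivAt c c' x.1) (v : ℝ × ℝ) :
    fderiv ℝ (fun x : ℝ × ℝ => (!₂[a x.1 * Real.cos x.2 + b x.1 * Real.sin x.2,
        a x.1 * Real.sin x.2 - b x.1 * Real.cos x.2, c x.1] : Space)) x v =
      !₂[v.1 * (a' * Real.cos x.2 + b' * Real.sin x.2) +
          v.2 * (b x.1 * Real.cos x.2 - a x.1 * Real.sin x.2),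
        v.1 * (a' * Real.sin x.2 - b' * Real.cos x.2) +
          v.2 * (a x.1 * Real.cos x.2 + b x.1 * Real.sin x.2), v.1 * c'] := by
  have ha := ha.hasFDerivAt.comp x (hasFDerivAt_fst (𝕜 := ℝ) (p := x))
  have hb := hb.hasFDerivAt.comp x (hasFDerivAt_fst (𝕜 := ℝ) (p := x))
  have hc := hc.hasFDerivAt.comp x (hasFDerivAt_fst (𝕜 := ℝ) (p := x))
  have hs := (Real.hasDerivAt_sin x.2).hasFDerivAt.comp x (hasFDerivAt_snd (𝕜 := ℝ) (p := x))
  have hk := (Real.hasDerivAt_cos x.2).hasFDerivAt.comp x (hasFDerivAt_snd (𝕜 := ℝ) (p := x))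
  obtain ⟨L, hL, hv⟩ := hasFDerivAt_space ((ha.mul hk).add (hb.mul hs))
    ((ha.mul hs).sub (hb.mul hk)) hc
  have hL' := hL.fderiv
  simp only [Function.comp_def, Pi.mul_apply, Pi.add_apply, Pi.sub_apply] at hL'
  rw [hL', hv]
  ext i
  fin_cases i <;> simp <;> ring

theorem fderiv_revolutionSurface {r h : ℝ → ℝ} {x : ℝ × ℝ} {r' h' : ℝ}
    (hr : HasDerivAt r r' x.1) (hh : HasDerivAt h h' x.1) (v : ℝ × ℝ) :
    fderiv ℝ (revolutionSurface r h) x v =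
      !₂[v.1 * (r' * Real.cos x.2) - v.2 * (r x.1 * Real.sin x.2),
        v.1 * (r' * Real.sin x.2) + v.2 * (r x.1 * Real.cos x.2), v.1 * h'] := by
  have key := fderiv_rotated hr (hasDerivAt_const x.1 (0 : ℝ)) hh v
  simp only [zero_mul, add_zero, sub_zero] at key
  refine key.trans ?_
  ext i
  fin_cases i <;> simp; ring

theorem partialFst_revolutionSurface {r h r' h' : ℝ → ℝ} (hr : ∀ s, HasDerivAt r (r' s) s)
    (hh : ∀ s, HasDerivAt h (h' s) s) :
    partialFst (revolutionSurface r h) = revolutionSurface r' h' := by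
  ext x : 1
  simp [partialFst, fderiv_revolutionSurface (hr _) (hh _), revolutionSurface]

theorem partialSnd_revolutionSurface {r h r' h' : ℝ → ℝ} (hr : ∀ s, HasDerivAt r (r' s) s)
    (hh : ∀ s, HasDerivAt h (h' s) s) :
    partialSnd (revolutionSurface r h) =
      fun x => !₂[-(r x.1 * Real.sin x.2), r x.1 * Real.cos x.2, 0] := by
  ext x : 1
  simp [partialSnd, fderiv_revolutionSurface (hr _) (hh _)]

theorem partialFst_partialSnd_revolutionSurface {r h r' h' : ℝ → ℝ}
    (hr : ∀ s, HasDerivAt r (r' s) s) (hh : ∀ s, HasDerivAt h (h' s) s) (x : ℝ × ℝ) :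
    partialFst (partialSnd (revolutionSurface r h)) x =
      !₂[-(r' x.1 * Real.sin x.2), r' x.1 * Real.cos x.2, 0] := by
  rw [partialSnd_revolutionSurface hr hh, partialFst]
  simpa using fderiv_rotated (hasDerivAt_const x.1 (0 : ℝ)) (hr x.1).neg
    (hasDerivAt_const x.1 (0 : ℝ)) (1, 0)

theorem partialSnd_partialSnd_revolutionSurface {r h r' h' : ℝ → ℝ}
    (hr : ∀ s, HasDerivAt r (r' s) s) (hh : ∀ s, HasDerivAt h (h' s) s) (x : ℝ × ℝ) :
    partialSnd (partialSnd (revolutionSurface r h)) x =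
      !₂[-(r x.1 * Real.cos x.2), -(r x.1 * Real.sin x.2), 0] := by
  rw [partialSnd_revolutionSurface hr hh, partialSnd]
  simpa using fderiv_rotated (hasDerivAt_const x.1 (0 : ℝ)) (hr x.1).neg
    (hasDerivAt_const x.1 (0 : ℝ)) (0, 1)

/-- The profile curve `(r, h)` has the unit tangent field `(σ', σ)` up to the factor `-A`,
where `(-σ, σ')` is its unit normal field, rotating with angular velocity `κ`. -/
structure IsFramedProfile (r h A σ τ κ : ℝ → ℝ) : Prop where
  unit : ∀ s, σ s ^ 2 + τ s ^ 2 = 1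
  deriv_radius : ∀ s, HasDerivAt r (-(A s * τ s)) s
  deriv_height : ∀ s, HasDerivAt h (-(A s * σ s)) s
  deriv_fst : ∀ s, HasDerivAt σ (κ s * τ s) s
  deriv_snd : ∀ s, HasDerivAt τ (-(κ s * σ s)) s

namespace IsFramedProfile

variable {r h A σ τ κ : ℝ → ℝ}

theorem coeffE_eq (H : IsFramedProfile r h A σ τ κ) (x : ℝ × ℝ) :
    coeffE (revolutionSurface r h) x = A x.1 ^ 2 := by
  simp only [coeffE, partialFst_revolutionSurface H.deriv_radius H.deriv_height,
    revolutionSurface, space_inner]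
  linear_combination A x.1 ^ 2 * H.unit x.1 +
    A x.1 ^ 2 * τ x.1 ^ 2 * Real.sin_sq_add_cos_sq x.2

theorem coeffF_eq (H : IsFramedProfile r h A σ τ κ) (x : ℝ × ℝ) :
    coeffF (revolutionSurface r h) x = 0 := by
  simp only [coeffF, partialFst_revolutionSurface H.deriv_radius H.deriv_height,
    partialSnd_revolutionSurface H.deriv_radius H.deriv_height, revolutionSurface, space_inner]
  ring

theorem coeffG_eq (H : IsFramedProfile r h A σ τ κ) (x : ℝ × ℝ) :
    coeffG (revolutionSurface r h) x = r x.1 ^ 2 := by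
  simp only [coeffG, partialSnd_revolutionSurface H.deriv_radius H.deriv_height, space_inner]
  linear_combination r x.1 ^ 2 * Real.sin_sq_add_cos_sq x.2

/-- The terms with `A'` are tangential and drop out of the product with the normal. -/
theorem coeffL_eq (H : IsFramedProfile r h A σ τ κ) (hA : Differentiable ℝ A) (x : ℝ × ℝ) :
    coeffL (revolutionSurface r h) (revolutionSurface (fun s => -σ s) τ) x =
      -(A x.1 * κ x.1) := by
  have h1 : ∀ s, HasDerivAt (fun s => -(A s * τ s))
      (-(deriv A s * τ s + A s * -(κ s * σ s))) s := fun s =>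
    ((hA s).hasDerivAt.mul (H.deriv_snd s)).neg
  have h2 : ∀ s, HasDerivAt (fun s => -(A s * σ s)) (-(deriv A s * σ s + A s * (κ s * τ s))) s :=
    fun s => ((hA s).hasDerivAt.mul (H.deriv_fst s)).neg
  simp only [coeffL, partialFst_revolutionSurface H.deriv_radius H.deriv_height,
    partialFst_revolutionSurface h1 h2, revolutionSurface, space_inner]
  linear_combination -(A x.1 * κ x.1) * H.unit x.1 +
    (deriv A x.1 * τ x.1 - A x.1 * κ x.1 * σ x.1) * σ x.1 * Real.sin_sq_add_cos_sq x.2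

theorem coeffM_eq (H : IsFramedProfile r h A σ τ κ) (x : ℝ × ℝ) :
    coeffM (revolutionSurface r h) (revolutionSurface (fun s => -σ s) τ) x = 0 := by
  simp only [coeffM, partialFst_partialSnd_revolutionSurface H.deriv_radius H.deriv_height,
    revolutionSurface, space_inner]
  ring

theorem coeffN_eq (H : IsFramedProfile r h A σ τ κ) (x : ℝ × ℝ) :
    coeffN (revolutionSurface r h) (revolutionSurface (fun s => -σ s) τ) x =
      r x.1 * σ x.1 := by
  simp only [coeffN, partialSnd_partialSnd_revolutionSurface H.deriv_radius H.deriv_height,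
    revolutionSurface, space_inner]
  linear_combination r x.1 * σ x.1 * Real.sin_sq_add_cos_sq x.2

theorem isUnitNormalField (H : IsFramedProfile r h A σ τ κ) (hσ : ContDiff ℝ ∞ σ)
    (hτ : ContDiff ℝ ∞ τ) :
    IsUnitNormalField (revolutionSurface r h) (revolutionSurface (fun s => -σ s) τ) := by
  refine ⟨contDiff_revolutionSurface hσ.neg hτ, fun x => ⟨?_, ?_, ?_⟩⟩
  · rw [← sq_eq_sq₀ (norm_nonneg _) zero_le_one, ← real_inner_self_eq_norm_sq]
    simp only [revolutionSurface, space_inner]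
    linear_combination H.unit x.1 + σ x.1 ^ 2 * Real.sin_sq_add_cos_sq x.2
  · simp only [partialFst_revolutionSurface H.deriv_radius H.deriv_height, revolutionSurface,
      space_inner]
    linear_combination A x.1 * σ x.1 * τ x.1 * Real.sin_sq_add_cos_sq x.2
  · simp only [partialSnd_revolutionSurface H.deriv_radius H.deriv_height, revolutionSurface,
      space_inner]
    ring

theorem norm_sq_fderiv (H : IsFramedProfile r h A σ τ κ) (x v : ℝ × ℝ) :
    ‖fderiv ℝ (revolutionSurface r h) x v‖ ^ 2 = (A x.1 * v.1) ^ 2 + (r x.1 * v.2) ^ 2 := by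
  rw [← real_inner_self_eq_norm_sq, fderiv_revolutionSurface (H.deriv_radius _) (H.deriv_height _),
    space_inner]
  linear_combination A x.1 ^ 2 * v.1 ^ 2 * H.unit x.1 +
    (A x.1 ^ 2 * τ x.1 ^ 2 * v.1 ^ 2 + r x.1 ^ 2 * v.2 ^ 2) * Real.sin_sq_add_cos_sq x.2

/-- The norm on `ℝ × ℝ` is the maximum norm, so one of the two squares in `norm_sq_fderiv` already
suffices. -/
theorem mul_norm_le_norm_fderiv (H : IsFramedProfile r h A σ τ κ) {m : ℝ} (hm : 0 ≤ m)
    {x : ℝ × ℝ} (hA : m ≤ A x.1) (hr : m ≤ r x.1) (v : ℝ × ℝ) :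
    m * ‖v‖ ≤ ‖fderiv ℝ (revolutionSurface r h) x v‖ := by
  have h0 := H.norm_sq_fderiv x v
  have hA' : m ^ 2 ≤ A x.1 ^ 2 := pow_le_pow_left₀ hm hA 2
  have hr' : m ^ 2 ≤ r x.1 ^ 2 := pow_le_pow_left₀ hm hr 2
  refine abs_le_of_sq_le_sq' ?_ (norm_nonneg _) |>.2
  rw [h0, mul_pow, Prod.norm_def]
  rcases max_choice ‖v.1‖ ‖v.2‖ with h | h <;> rw [h, Real.norm_eq_abs, sq_abs]
  · nlinarith [mul_le_mul_of_nonneg_right hA' (sq_nonneg v.1), sq_nonneg (r x.1 * v.2)]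
  · nlinarith [mul_le_mul_of_nonneg_right hr' (sq_nonneg v.2), sq_nonneg (A x.1 * v.1)]

end IsFramedProfile

/-! ### Completeness of the induced metric -/

theorem deriv_comp_curve {f : ℝ × ℝ → Space} (hf : ContDiff ℝ 1 f) {γ : ℝ → ℝ × ℝ}
    {γ' : ℝ × ℝ} {τ : ℝ} (hγ : HasDerivAt γ γ' τ) :
    deriv (f ∘ γ) τ = fderiv ℝ f (γ τ) γ' :=
  ((hf.differentiable one_ne_zero (γ τ)).hasFDerivAt.comp_hasDerivAt τ hγ).deriv

theorem edist_le_lintegral_deriv {γ : ℝ → ℝ × ℝ} (hγ : ContDiff ℝ 1 γ) :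
    edist (γ 0) (γ 1) ≤ ∫⁻ τ in Icc (0 : ℝ) 1, ‖deriv γ τ‖ₑ := by
  have hc : Continuous (deriv γ) := hγ.continuous_deriv le_rfl
  have := intervalIntegral.integral_deriv_eq_sub (a := 0) (b := 1)
    (fun x _ => hγ.differentiable one_ne_zero x) (hc.intervalIntegrable _ _)
  rw [edist_comm, edist_eq_enorm_sub, ← this, intervalIntegral.integral_of_le zero_le_one,
    ← integral_Icc_eq_integral_Ioc]
  exact enorm_integral_le_lintegral_enorm _

theorem mul_edist_le_inducedEDist {f : ℝ × ℝ → Space} (hf : ContDiff ℝ 1 f) {m : ℝ} (hm : 0 ≤ m)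
    (hfm : ∀ x v, m * ‖v‖ ≤ ‖fderiv ℝ f x v‖) (x y : ℝ × ℝ) :
    ENNReal.ofReal m * edist x y ≤ inducedEDist f x y := by
  refine le_iInf₂ fun γ hγ => ?_
  obtain ⟨hγ, rfl, rfl⟩ := hγ
  refine (mul_le_mul_right (edist_le_lintegral_deriv hγ) _).trans ?_
  rw [← lintegral_const_mul' _ _ ENNReal.ofReal_ne_top]
  refine lintegral_mono fun τ => ?_
  rw [deriv_comp_curve hf (hγ.differentiable one_ne_zero τ).hasDerivAt,
    ← ofReal_norm, ← ofReal_norm, ← ENNReal.ofReal_mul hm]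
  exact ENNReal.ofReal_le_ofReal (hfm _ _)

/-- The straight segment is an admissible path and, by convexity, stays where the derivative is
bounded. -/
theorem inducedEDist_le_mul_edist {f : ℝ × ℝ → Space} (hf : ContDiff ℝ 1 f) {U : Set (ℝ × ℝ)}
    (hU : Convex ℝ U) {M : ℝ} (hM : 0 ≤ M) (hfM : ∀ z ∈ U, ‖fderiv ℝ f z‖ ≤ M) {x y : ℝ × ℝ}
    (hx : x ∈ U) (hy : y ∈ U) :
    inducedEDist f x y ≤ ENNReal.ofReal M * edist x y := by
  refine (iInf₂_le (fun τ : ℝ => AffineMap.lineMap x y τ)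
    ⟨by simp only [AffineMap.lineMap_apply_module']; fun_prop, by simp, by simp⟩).trans ?_
  have : ∀ τ ∈ Icc (0 : ℝ) 1, ‖deriv (f ∘ fun τ : ℝ => AffineMap.lineMap x y τ) τ‖ₑ ≤
      ENNReal.ofReal M * edist x y := fun τ hτ => by
    rw [deriv_comp_curve hf AffineMap.hasDerivAt_lineMap, edist_comm, edist_eq_enorm_sub,
      ← ofReal_norm, ← ofReal_norm, ← ENNReal.ofReal_mul hM]
    exact ENNReal.ofReal_le_ofReal ((ContinuousLinearMap.le_opNorm _ _).trans
      (mul_le_mul_of_nonneg_right (hfM _ (hU.lineMap_mem hx hy hτ)) (norm_nonneg _)))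
  exact (setLIntegral_mono measurable_const this).trans (by simp)

/-- The lower bound makes a Cauchy sequence of the induced metric Cauchy in the parameter plane. At
its limit the derivative is locally bounded, so convergence there transfers back to the induced
metric. -/
theorem isCompleteSurface_of_le_norm_fderiv {f : ℝ × ℝ → Space} (hf : ContDiff ℝ 1 f) {m : ℝ}
    (hm : 0 < m) (hfm : ∀ x v, m * ‖v‖ ≤ ‖fderiv ℝ f x v‖) : IsCompleteSurface f := by
  intro u hu
  have hm0 : ENNReal.ofReal m ≠ 0 := (ENNReal.ofReal_pos.2 hm).ne'
  have hcauchy : CauchySeq u := by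
    rw [EMetric.cauchySeq_iff]
    intro ε hε
    obtain ⟨k, hk⟩ := hu (ENNReal.ofReal m * ε) (ENNReal.mul_pos hm0 hε.ne')
    refine ⟨k, fun i hi j hj => ?_⟩
    have := (mul_edist_le_inducedEDist hf hm.le hfm _ _).trans_lt (hk i hi j hj)
    exact lt_of_mul_lt_mul_left' this
  obtain ⟨x, hx⟩ := cauchySeq_tendsto_of_complete hcauchy
  refine ⟨x, ?_⟩
  have hcont : Continuous fun z => ‖fderiv ℝ f z‖ := (hf.continuous_fderiv one_ne_zero).norm
  obtain ⟨ε, hε, hball⟩ := Metric.mem_nhds_iff.1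
    (hcont.continuousAt.eventually_le_const (lt_add_one ‖fderiv ℝ f x‖))
  have hlim : Tendsto (fun i => ENNReal.ofReal (‖fderiv ℝ f x‖ + 1) * edist (u i) x) atTop
      (𝓝 0) := by
    have := ENNReal.Tendsto.const_mul (tendsto_iff_edist_tendsto_0.1 hx)
      (Or.inr (ENNReal.ofReal_ne_top (r := ‖fderiv ℝ f x‖ + 1)))
    simpa using this
  refine tendsto_of_tendsto_of_tendsto_of_le_of_le' tendsto_const_nhds hlim
    (Eventually.of_forall fun _ => zero_le) ?_
  filter_upwards [hx (Metric.ball_mem_nhds x hε)] with i hi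
  exact inducedEDist_le_mul_edist hf (convex_ball x ε) (by positivity) (fun z hz => hball hz) hi
    (Metric.mem_ball_self hε)

/-! ### The parallel surfaces of the surface of dn type -/

/-- Radius of the parallel surface at distance `t`. -/
noncomputable def parallelRadius (p t s : ℝ) : ℝ := dnRadius p s - t * jacobiSn p (s / p)

/-- Height of the parallel surface at distance `t`. -/
noncomputable def parallelHeight (p t s : ℝ) : ℝ := dnHeight p s + t * jacobiCn p (s / p)

/-- Signed speed of the profile curve of the parallel surface at distance `t`. -/
noncomputable def parallelSpeed (p t s : ℝ) : ℝ := jacobiSn p (s / p) + t * dnRadius p s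

theorem parallelSurface_dnSurface (p t : ℝ) :
    parallelSurface (dnSurface p) (dnNormal p) t =
      revolutionSurface (parallelRadius p t) (parallelHeight p t) := by
  ext x i
  fin_cases i <;>
    simp [parallelSurface, dnSurface, dnNormal, revolutionSurface, parallelRadius,
      parallelHeight] <;> ring

theorem parallelSurface_zero (f n : ℝ × ℝ → Space) : parallelSurface f n 0 = f := by
  ext x : 1
  simp [parallelSurface]

theorem dnRadius_sq {p : ℝ} (hp0 : 0 < p) (hp1 : p < 1) (s : ℝ) :
    dnRadius p s ^ 2 = 1 / p ^ 2 - jacobiSn p (s / p) ^ 2 := by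
  rw [dnRadius, mul_pow, jacobiDn_sq hp0 hp1]
  field_simp

theorem dnRadius_pos {p : ℝ} (hp0 : 0 < p) (hp1 : p < 1) (s : ℝ) : 0 < dnRadius p s :=
  mul_pos (one_div_pos.2 hp0) (jacobiDn_pos hp0 hp1 _)

theorem hasDerivAt_dnRadius {p : ℝ} (hp0 : 0 < p) (hp1 : p < 1) (s : ℝ) :
    HasDerivAt (dnRadius p) (-(jacobiSn p (s / p) * jacobiCn p (s / p))) s := by
  refine (((hasDerivAt_jacobiDn hp0 hp1 (s / p)).comp s
    ((hasDerivAt_id s).div_const p)).const_mul (1 / p)).congr_deriv ?_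
  field_simp

theorem hasDerivAt_dnHeight {p : ℝ} (hp0 : 0 < p) (hp1 : p < 1) (s : ℝ) :
    HasDerivAt (dnHeight p) (-jacobiSn p (s / p) ^ 2) s := by
  have hE : HasDerivAt (fun u => ellipticE p (jacobiAm p u))
      (jacobiDn p (s / p) * jacobiDn p (s / p)) (s / p) :=
    (hasDerivAt_ellipticE p _).comp (s / p) (hasDerivAt_jacobiAm hp0 hp1 (s / p))
  refine (((hE.comp s ((hasDerivAt_id s).div_const p)).const_mul (1 / p)).sub
    ((hasDerivAt_id s).const_mul (1 / p ^ 2))).congr_deriv ?_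
  field_simp
  linear_combination jacobiDn_sq hp0 hp1 (s / p)

theorem contDiff_dnRadius {p : ℝ} (hp0 : 0 < p) (hp1 : p < 1) : ContDiff ℝ ∞ (dnRadius p) :=
  contDiff_const.mul ((contDiff_jacobiDn hp0 hp1).comp (contDiff_id.div_const p))

theorem contDiff_dnHeight {p : ℝ} (hp0 : 0 < p) (hp1 : p < 1) : ContDiff ℝ ∞ (dnHeight p) := by
  refine contDiff_infty_iff_deriv.2
    ⟨fun s => (hasDerivAt_dnHeight hp0 hp1 s).differentiableAt, ?_⟩
  rw [funext fun s => (hasDerivAt_dnHeight hp0 hp1 s).deriv]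
  exact (((contDiff_jacobiSn hp0 hp1).comp (contDiff_id.div_const p)).pow 2).neg

/-- The coincidence of the radius `dnRadius p` with the angular velocity of the frame is what brings
the speed to the form `sn + t · dnRadius`. -/
theorem isFramedProfile_parallel {p : ℝ} (hp0 : 0 < p) (hp1 : p < 1) (t : ℝ) :
    IsFramedProfile (parallelRadius p t) (parallelHeight p t) (parallelSpeed p t)
      (fun s => jacobiSn p (s / p)) (fun s => jacobiCn p (s / p)) (dnRadius p) := by
  have hS : ∀ s, HasDerivAt (fun s => jacobiSn p (s / p))
      (dnRadius p s * jacobiCn p (s / p)) s := fun s => by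
    refine ((hasDerivAt_jacobiSn hp0 hp1 (s / p)).comp s
      ((hasDerivAt_id s).div_const p)).congr_deriv ?_
    simp only [dnRadius]
    ring
  have hC : ∀ s, HasDerivAt (fun s => jacobiCn p (s / p))
      (-(dnRadius p s * jacobiSn p (s / p))) s := fun s => by
    refine ((hasDerivAt_jacobiCn hp0 hp1 (s / p)).comp s
      ((hasDerivAt_id s).div_const p)).congr_deriv ?_
    simp only [dnRadius]
    ring
  refine ⟨fun s => jacobiSn_sq_add_jacobiCn_sq p _, fun s => ?_, fun s => ?_, hS, hC⟩
  · exact ((hasDerivAt_dnRadius hp0 hp1 s).sub ((hS s).const_mul t)).congr_deriv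
      (by simp only [parallelSpeed]; ring)
  · exact ((hasDerivAt_dnHeight hp0 hp1 s).add ((hC s).const_mul t)).congr_deriv
      (by simp only [parallelSpeed]; ring)

theorem differentiable_parallelSpeed {p : ℝ} (hp0 : 0 < p) (hp1 : p < 1) (t : ℝ) :
    Differentiable ℝ (parallelSpeed p t) := fun s =>
  ((isFramedProfile_parallel hp0 hp1 t).deriv_fst s).differentiableAt.add
    ((hasDerivAt_dnRadius hp0 hp1 s).differentiableAt.const_mul t)

theorem contDiff_parallelSurface_dnSurface {p : ℝ} (hp0 : 0 < p) (hp1 : p < 1) (t : ℝ) :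
    ContDiff ℝ ∞ (parallelSurface (dnSurface p) (dnNormal p) t) := by
  rw [parallelSurface_dnSurface]
  exact contDiff_revolutionSurface
    ((contDiff_dnRadius hp0 hp1).sub
      (contDiff_const.mul ((contDiff_jacobiSn hp0 hp1).comp (contDiff_id.div_const p))))
    ((contDiff_dnHeight hp0 hp1).add
      (contDiff_const.mul ((contDiff_jacobiCn hp0 hp1).comp (contDiff_id.div_const p))))

theorem isUnitNormalField_parallel {p : ℝ} (hp0 : 0 < p) (hp1 : p < 1) (t : ℝ) :
    IsUnitNormalField (parallelSurface (dnSurface p) (dnNormal p) t) (dnNormal p) := by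
  rw [parallelSurface_dnSurface]
  exact (isFramedProfile_parallel hp0 hp1 t).isUnitNormalField
    ((contDiff_jacobiSn hp0 hp1).comp (contDiff_id.div_const p))
    ((contDiff_jacobiCn hp0 hp1).comp (contDiff_id.div_const p))

theorem gaussCurvature_parallel {p : ℝ} (hp0 : 0 < p) (hp1 : p < 1) (t : ℝ) (x : ℝ × ℝ) :
    gaussCurvature (parallelSurface (dnSurface p) (dnNormal p) t) (dnNormal p) x =
      -(parallelSpeed p t x.1 * dnRadius p x.1) *
        (parallelRadius p t x.1 * jacobiSn p (x.1 / p)) /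
        (parallelSpeed p t x.1 ^ 2 * parallelRadius p t x.1 ^ 2) := by
  have H := isFramedProfile_parallel hp0 hp1 t
  rw [parallelSurface_dnSurface, dnNormal]
  simp only [gaussCurvature, H.coeffE_eq, H.coeffF_eq,
    H.coeffG_eq, H.coeffL_eq (differentiable_parallelSpeed hp0 hp1 t), H.coeffM_eq, H.coeffN_eq]
  ring

theorem meanCurvature_parallel {p : ℝ} (hp0 : 0 < p) (hp1 : p < 1) (t : ℝ) (x : ℝ × ℝ) :
    meanCurvature (parallelSurface (dnSurface p) (dnNormal p) t) (dnNormal p) x =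
      (parallelSpeed p t x.1 ^ 2 * (parallelRadius p t x.1 * jacobiSn p (x.1 / p)) -
        parallelRadius p t x.1 ^ 2 * (parallelSpeed p t x.1 * dnRadius p x.1)) /
        (2 * (parallelSpeed p t x.1 ^ 2 * parallelRadius p t x.1 ^ 2)) := by
  have H := isFramedProfile_parallel hp0 hp1 t
  rw [parallelSurface_dnSurface, dnNormal]
  simp only [meanCurvature, H.coeffE_eq, H.coeffF_eq,
    H.coeffG_eq, H.coeffL_eq (differentiable_parallelSpeed hp0 hp1 t), H.coeffM_eq, H.coeffN_eq]
  ring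

theorem gaussCurvature_dnSurface {p : ℝ} (hp0 : 0 < p) (hp1 : p < 1) {x : ℝ × ℝ}
    (hx : IsRegularAt (dnSurface p) x) :
    gaussCurvature (dnSurface p) (dnNormal p) x = -1 := by
  have H := isFramedProfile_parallel hp0 hp1 0
  -- At `t = 0` the speed is `sn`; where it vanishes, `(1, 0)` lies in the kernel of the derivative.
  have hS : jacobiSn p (x.1 / p) ≠ 0 := fun h0 => by
    have h1 := H.norm_sq_fderiv x (1, 0)
    rw [← parallelSurface_dnSurface, parallelSurface_zero] at h1
    have h2 : fderiv ℝ (dnSurface p) x (1, 0) = fderiv ℝ (dnSurface p) x 0 := by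
      simpa [parallelSpeed, h0] using h1
    simpa using congrArg Prod.fst (hx h2)
  have hD := (dnRadius_pos hp0 hp1 x.1).ne'
  have := gaussCurvature_parallel hp0 hp1 0 x
  rw [parallelSurface_zero] at this
  rw [this]
  simp only [parallelSpeed, parallelRadius, zero_mul, add_zero, sub_zero]
  field_simp

/-! ### Uniform lower bounds, and the properties of the parallel surfaces -/

theorem sqrt_le_mul_dnRadius {p : ℝ} (hp0 : 0 < p) (s : ℝ) :
    √(1 - p ^ 2) ≤ p * dnRadius p s := by
  rw [dnRadius, ← mul_assoc, mul_one_div_cancel hp0.ne', one_mul]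
  refine Real.sqrt_le_sqrt ?_
  have h : jacobiSn p (s / p) ^ 2 ≤ 1 := Real.sin_sq_le_one _
  nlinarith [sq_nonneg p]

theorem le_parallelSpeed {p t : ℝ} (hp0 : 0 < p) (ht : 0 ≤ t) (s : ℝ) :
    t * (√(1 - p ^ 2) / p) - 1 ≤ parallelSpeed p t s := by
  have h1 : √(1 - p ^ 2) / p ≤ dnRadius p s := by
    rw [div_le_iff₀' hp0]
    exact sqrt_le_mul_dnRadius hp0 s
  have h2 : -1 ≤ jacobiSn p (s / p) := Real.neg_one_le_sin _
  have := mul_le_mul_of_nonneg_left h1 ht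
  rw [parallelSpeed]
  linarith

theorem le_parallelRadius {p t : ℝ} (hp0 : 0 < p) (ht : 0 ≤ t) (s : ℝ) :
    √(1 - p ^ 2) / p - t ≤ parallelRadius p t s := by
  have h1 : √(1 - p ^ 2) / p ≤ dnRadius p s := by
    rw [div_le_iff₀' hp0]
    exact sqrt_le_mul_dnRadius hp0 s
  have h2 : jacobiSn p (s / p) ≤ 1 := Real.sin_le_one _
  have := mul_le_mul_of_nonneg_left h2 ht
  rw [parallelRadius]
  linarith

theorem exists_pos_le_parallel {p t : ℝ} (hp0 : 0 < p) (hp1 : p < 1)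
    (ht : t ∈ Ioo (p / √(1 - p ^ 2)) (√(1 - p ^ 2) / p)) :
    ∃ m > 0, ∀ s, m ≤ parallelSpeed p t s ∧ m ≤ parallelRadius p t s := by
  have hq : 0 < √(1 - p ^ 2) := Real.sqrt_pos.2 (by nlinarith)
  have ht0 : 0 < t := (div_pos hp0 hq).trans ht.1
  have h1 : 0 < t * (√(1 - p ^ 2) / p) - 1 := by
    have := (div_lt_iff₀ hq).1 ht.1
    rw [← mul_div_assoc, sub_pos, lt_div_iff₀ hp0]
    linarith
  exact ⟨min _ _, lt_min h1 (sub_pos.2 ht.2), fun s =>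
    ⟨(min_le_left _ _).trans (le_parallelSpeed hp0 ht0.le s),
      (min_le_right _ _).trans (le_parallelRadius hp0 ht0.le s)⟩⟩

theorem exists_pos_mul_norm_le_norm_fderiv_parallel {p t : ℝ} (hp0 : 0 < p) (hp1 : p < 1)
    (ht : t ∈ Ioo (p / √(1 - p ^ 2)) (√(1 - p ^ 2) / p)) :
    ∃ m > 0, ∀ x v,
      m * ‖v‖ ≤ ‖fderiv ℝ (parallelSurface (dnSurface p) (dnNormal p) t) x v‖ := by
  obtain ⟨m, hm, h⟩ := exists_pos_le_parallel hp0 hp1 ht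
  rw [parallelSurface_dnSurface]
  exact ⟨m, hm, fun x v => (isFramedProfile_parallel hp0 hp1 t).mul_norm_le_norm_fderiv hm.le
    (h x.1).1 (h x.1).2 v⟩

theorem isImmersedSurface_parallel {p t : ℝ} (hp0 : 0 < p) (hp1 : p < 1)
    (ht : t ∈ Ioo (p / √(1 - p ^ 2)) (√(1 - p ^ 2) / p)) :
    IsImmersedSurface (parallelSurface (dnSurface p) (dnNormal p) t) := by
  obtain ⟨m, hm, h⟩ := exists_pos_mul_norm_le_norm_fderiv_parallel hp0 hp1 ht
  refine ⟨contDiff_parallelSurface_dnSurface hp0 hp1 t, fun x => ?_⟩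
  refine (injective_iff_map_eq_zero _).2 fun v hv => ?_
  have hmv := h x v
  rw [hv, norm_zero] at hmv
  exact norm_le_zero_iff.1 (nonpos_of_mul_nonpos_right hmv hm)

theorem isCompleteSurface_parallel {p t : ℝ} (hp0 : 0 < p) (hp1 : p < 1)
    (ht : t ∈ Ioo (p / √(1 - p ^ 2)) (√(1 - p ^ 2) / p)) :
    IsCompleteSurface (parallelSurface (dnSurface p) (dnNormal p) t) := by
  obtain ⟨m, hm, h⟩ := exists_pos_mul_norm_le_norm_fderiv_parallel hp0 hp1 ht
  exact isCompleteSurface_of_le_norm_fderiv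
    ((contDiff_parallelSurface_dnSurface hp0 hp1 t).of_le (by simp)) hm h

theorem isHyperbolicLinearWeingarten_parallel {p t : ℝ} (hp0 : 0 < p) (hp1 : p < 1)
    (ht : t ∈ Ioo (p / √(1 - p ^ 2)) (√(1 - p ^ 2) / p)) :
    IsHyperbolicLinearWeingarten (parallelSurface (dnSurface p) (dnNormal p) t)
      (dnNormal p) := by
  obtain ⟨m, hm, h⟩ := exists_pos_le_parallel hp0 hp1 ht
  refine ⟨1 + t ^ 2, t, 1, by linarith, fun x => ?_⟩
  have hA : parallelSpeed p t x.1 ≠ 0 := (hm.trans_le (h x.1).1).ne'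
  have hB : parallelRadius p t x.1 ≠ 0 := (hm.trans_le (h x.1).2).ne'
  have eA : parallelSpeed p t x.1 = jacobiSn p (x.1 / p) + t * dnRadius p x.1 := rfl
  have eB : parallelRadius p t x.1 = dnRadius p x.1 - t * jacobiSn p (x.1 / p) := rfl
  rw [gaussCurvature_parallel hp0 hp1, meanCurvature_parallel hp0 hp1]
  generalize parallelSpeed p t x.1 = A at *
  generalize parallelRadius p t x.1 = B at *
  -- With `A, B` as nonzero atoms the denominators clear; substituting their expressions leaves a
  -- polynomial identity.
  field_simp
  rw [eA, eB]
  ring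

theorem hasTranslationalPeriod_parallel {p : ℝ} (hp0 : 0 < p) (hp1 : p < 1) (t : ℝ) :
    HasTranslationalPeriod (parallelSurface (dnSurface p) (dnNormal p) t) := by
  have hF := ellipticF_two_pi_pos hp0 hp1
  have hs : ∀ s, (s + p * ellipticF p (2 * π)) / p = s / p + ellipticF p (2 * π) := fun s => by
    field_simp
  -- One full turn of the amplitude. The height gains `E(2π)/p` and loses `pF(2π)/p²`.
  refine ⟨p * ellipticF p (2 * π), 1 / p * (ellipticE p (2 * π) - ellipticF p (2 * π)),
    mul_pos hp0 hF, mul_ne_zero (one_div_pos.2 hp0).ne' (sub_neg.2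
      (ellipticE_two_pi_lt_ellipticF_two_pi hp0 hp1)).ne, fun s θ => ?_⟩
  have hS : jacobiSn p (s / p + ellipticF p (2 * π)) = jacobiSn p (s / p) := by
    simp [jacobiSn, jacobiAm_add_ellipticF_two_pi hp0 hp1]
  have hC : jacobiCn p (s / p + ellipticF p (2 * π)) = jacobiCn p (s / p) := by
    simp [jacobiCn, jacobiAm_add_ellipticF_two_pi hp0 hp1]
  have hr : parallelRadius p t (s + p * ellipticF p (2 * π)) = parallelRadius p t s := by
    simp only [parallelRadius, dnRadius, jacobiDn, hs, hS]
  have hh : parallelHeight p t (s + p * ellipticF p (2 * π)) = parallelHeight p t s +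
      1 / p * (ellipticE p (2 * π) - ellipticF p (2 * π)) := by
    simp only [parallelHeight, dnHeight, hs, hC, jacobiAm_add_ellipticF_two_pi hp0 hp1,
      ellipticE_add_two_pi]
    field_simp
    ring
  rw [parallelSurface_dnSurface]
  ext i
  fin_cases i <;> simp [revolutionSurface, hr, hh]

/-! ### Different distances give different surfaces -/

/-- With `S = sn` and `q = √(1 - p²)`: `dn - q = p²(1 - S²)/(dn + q) ≤ p²(1 + S)/q ≤ pt(1 + S)`,
using `dn ≥ q` and `p ≤ tq`. Dividing by `p` and subtracting `tS` gives the bound. -/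
theorem parallelRadius_le {p t : ℝ} (hp0 : 0 < p) (hp1 : p < 1) (ht : p / √(1 - p ^ 2) ≤ t)
    (s : ℝ) : parallelRadius p t s ≤ √(1 - p ^ 2) / p + t := by
  have hq : 0 < √(1 - p ^ 2) := Real.sqrt_pos.2 (by nlinarith)
  have hq2 : √(1 - p ^ 2) ^ 2 = 1 - p ^ 2 := Real.sq_sqrt (by nlinarith)
  have hD := sqrt_le_mul_dnRadius hp0 s
  have hD2 : (p * dnRadius p s) ^ 2 = 1 - p ^ 2 * jacobiSn p (s / p) ^ 2 := by
    rw [mul_pow, dnRadius_sq hp0 hp1]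
    field_simp
  have h1 : 0 ≤ 1 + jacobiSn p (s / p) := by
    have : -1 ≤ jacobiSn p (s / p) := Real.neg_one_le_sin _
    linarith
  have h2 : jacobiSn p (s / p) ≤ 1 := Real.sin_le_one _
  have htq : p ≤ t * √(1 - p ^ 2) := (div_le_iff₀ hq).1 ht
  rw [parallelRadius]
  generalize jacobiSn p (s / p) = S at *
  generalize √(1 - p ^ 2) = q at *
  generalize dnRadius p s = D at *
  have key : (p * D - q) * (2 * q) ≤ p * t * (1 + S) * (2 * q) := by
    calc (p * D - q) * (2 * q) ≤ (p * D - q) * (p * D + q) := by gcongr; all_goals linarith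
      _ = p ^ 2 * (1 + S) * (1 - S) := by linear_combination hD2 - hq2
      _ ≤ p ^ 2 * (1 + S) * 2 := by gcongr; linarith
      _ = p * p * (1 + S) * 2 := by ring
      _ ≤ p * (t * q) * (1 + S) * 2 := by gcongr
      _ = _ := by ring
  have := le_of_mul_le_mul_right key (by positivity)
  refine le_of_mul_le_mul_left (a := p) ?_ hp0
  rw [mul_add, mul_div_cancel₀ _ hp0.ne']
  linarith

/-- At amplitude `-π/2` one has `sn = -1` and `dn = q`, so the upper bound for the radius is
attained. -/
theorem exists_parallelRadius_eq {p : ℝ} (hp0 : 0 < p) (hp1 : p < 1) (t : ℝ) :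
    ∃ s, parallelRadius p t s = √(1 - p ^ 2) / p + t := by
  have h : jacobiSn p (p * ellipticF p (-(π / 2)) / p) = -1 := by
    simp [jacobiSn, mul_div_cancel_left₀ _ hp0.ne', jacobiAm_ellipticF hp0 hp1]
  refine ⟨p * ellipticF p (-(π / 2)), ?_⟩
  simp only [parallelRadius, dnRadius, jacobiDn, h]
  ring_nf

theorem le_of_range_parallel_subset {p t t' : ℝ} (hp0 : 0 < p) (hp1 : p < 1)
    (ht : t ∈ Ioo (p / √(1 - p ^ 2)) (√(1 - p ^ 2) / p))
    (hsub : range (parallelSurface (dnSurface p) (dnNormal p) t') ⊆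
      range (parallelSurface (dnSurface p) (dnNormal p) t)) : t' ≤ t := by
  obtain ⟨s, hs⟩ := exists_parallelRadius_eq hp0 hp1 t'
  obtain ⟨y, hy⟩ := hsub ⟨(s, 0), rfl⟩
  obtain ⟨m, hm, hB⟩ := exists_pos_le_parallel hp0 hp1 ht
  rw [parallelSurface_dnSurface, parallelSurface_dnSurface] at hy
  have h0 := congrArg (fun z : Space => z 0) hy
  have h1 := congrArg (fun z : Space => z 1) hy
  simp only [revolutionSurface, PiLp.toLp_apply, Matrix.cons_val_zero, Matrix.cons_val_one,
    Real.cos_zero, Real.sin_zero, mul_one, mul_zero] at h0 h1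
  -- Both sides are the squared distance to the axis of the common point; positivity of the radius
  -- for `t` then allows taking roots.
  have hsq : parallelRadius p t' s ^ 2 = parallelRadius p t y.1 ^ 2 := by
    rw [← h0]
    linear_combination parallelRadius p t y.1 ^ 2 * Real.sin_sq_add_cos_sq y.2 -
      parallelRadius p t y.1 * Real.sin y.2 * h1
  have h2 := abs_le_of_sq_le_sq' hsq.le (hm.le.trans (hB y.1).2) |>.2
  have h3 := parallelRadius_le hp0 hp1 ht.1.le y.1
  linarith

theorem mainTheorem4 (p : ℝ) (hp0 : 0 < p) (hp : p < 1 / √2) :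
    -- the surface of dn type is pseudospherical, with a globally defined unit normal field
    ContDiff ℝ ∞ (dnSurface p) ∧
    IsUnitNormalField (dnSurface p) (dnNormal p) ∧
    (∀ x, IsRegularAt (dnSurface p) x → gaussCurvature (dnSurface p) (dnNormal p) x = -1) ∧
    -- the interval of distances is not empty
    p / √(1 - p ^ 2) < √(1 - p ^ 2) / p ∧
    -- the parallel surfaces
    (∀ t ∈ Ioo (p / √(1 - p ^ 2)) (√(1 - p ^ 2) / p),
      (∃ r h : ℝ → ℝ, parallelSurface (dnSurface p) (dnNormal p) t = revolutionSurface r h) ∧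
      IsImmersedSurface (parallelSurface (dnSurface p) (dnNormal p) t) ∧
      IsCompleteSurface (parallelSurface (dnSurface p) (dnNormal p) t) ∧
      IsUnitNormalField (parallelSurface (dnSurface p) (dnNormal p) t) (dnNormal p) ∧
      IsHyperbolicLinearWeingarten (parallelSurface (dnSurface p) (dnNormal p) t) (dnNormal p) ∧
      HasTranslationalPeriod (parallelSurface (dnSurface p) (dnNormal p) t)) ∧
    -- different distances give different surfaces
    InjOn (fun t => range (parallelSurface (dnSurface p) (dnNormal p) t))
      (Ioo (p / √(1 - p ^ 2)) (√(1 - p ^ 2) / p)) := by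
  have hp1 : p < 1 := hp.trans_le (by
    rw [div_le_one (by positivity)]
    exact Real.one_le_sqrt.2 one_le_two)
  have hpq : p / √(1 - p ^ 2) < √(1 - p ^ 2) / p := by
    have hq : 0 < √(1 - p ^ 2) := Real.sqrt_pos.2 (by nlinarith)
    have hp2 : p ^ 2 < 1 / 2 := by
      have := pow_lt_pow_left₀ hp hp0.le two_ne_zero
      rwa [div_pow, Real.sq_sqrt zero_le_two, one_pow] at this
    rw [div_lt_div_iff₀ hq hp0, Real.mul_self_sqrt (by linarith)]
    linarith
  -- The original surface is the parallel surface at distance `0`; smoothness and the normal field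
  -- need no restriction on `t`.
  have h0 := isUnitNormalField_parallel hp0 hp1 0
  have h1 := contDiff_parallelSurface_dnSurface hp0 hp1 0
  rw [parallelSurface_zero] at h0 h1
  exact ⟨h1, h0, fun x hx => gaussCurvature_dnSurface hp0 hp1 hx, hpq, fun t ht =>
    ⟨⟨_, _, parallelSurface_dnSurface p t⟩, isImmersedSurface_parallel hp0 hp1 ht,
      isCompleteSurface_parallel hp0 hp1 ht, isUnitNormalField_parallel hp0 hp1 t,
      isHyperbolicLinearWeingarten_parallel hp0 hp1 ht, hasTranslationalPeriod_parallel hp0 hp1 t⟩,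
    fun t ht t' ht' h => le_antisymm (le_of_range_parallel_subset hp0 hp1 ht' h.le)
      (le_of_range_parallel_subset hp0 hp1 ht h.ge)⟩
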